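/- Let $k$ be an algebraically closed field and let $\mathcal{C}$ be a $k$-linear triangulated category with split idempotents and suspension functor $\Sigma$. Assume that $\mathcal{C}$ is Hom-finite (all spaces $\mathcal{C}(X,Y)$ are finite-dimensional over $k$) and $2$-Calabi--Yau, i.e. there are $k$-linear isomorphisms $\mathcal{C}(X,\Sigma Y)\simeq \operatorname{Hom}_k(\mathcal{C}(Y,\Sigma X),k)$, natural in $X$ and $Y$. Let $T$ be a cluster-tilting object of $\mathcal{C}$: $\mathcal{C}(T,\Sigma T)=0$, and every object $X$ with $\mathcal{C}(X,\Sigma T)=0$ is a direct summand of a finite direct sum of copies of $T$. Let $B=\operatorname{End}_{\mathcal{C}}(T)$ and let $\operatorname{mod}B$ be the category of finite-dimensional right $B$-modules. Let $\mathrm{K}_0^{\mathrm{sp}}(\operatorname{mod}B)$ (resp. $\mathrm{K}_0(\operatorname{mod}B)$) be the quotient of the free abelian group on the isomorphism classes $[N]$ of finite-dimensional right $B$-modules by the subgroup generated by all $[N_1\oplus N_2]-[N_1]-[N_2]$ (resp. by all $[Y]-[X]-[Z]$ for short exact sequences $0\to X\to Y\to Z\to 0$ in $\operatorname{mod}B$),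 and let $\pi:\mathrm{K}_0^{\mathrm{sp}}(\operatorname{mod}B)\to \mathrm{K}_0(\operatorname{mod}B)$ be the canonical surjection. Let $\langle\;,\;\rangle$ be the bilinear form on $\mathrm{K}_0^{\mathrm{sp}}(\operatorname{mod}B)$ with $$\langle [N],[N']\rangle=\dim_k\operatorname{Hom}_B(N,N')-\dim_k\operatorname{Ext}^1_B(N,N'),$$ and put $\langle x,y\rangle_a=\langle x,y\rangle-\langle y,x\rangle$. Then the antisymmetric bilinear form $\langle\;,\;\rangle_a$ descends to $\mathrm{K}_0(\operatorname{mod}B)$: there is a unique bilinear form $\beta:\mathrm{K}_0(\operatorname{mod}B)\times \mathrm{K}_0(\operatorname{mod}B)\to\mathbb{Z}$ such that $\beta(\pi x,\pi y)=\langle x,y\rangle_a$ for all $x,y\in\mathrm{K}_0^{\mathrm{sp}}(\operatorname{mod}B)$, and $\beta$ is antisymmetric. In particular, for every indecomposable direct summand $T_i$ of $T$, with $S_i$ the top of the right $B$-module $\mathcal{C}(T,T_i)$, the linear form $\langle [S_i],?\rangle_a$ induces a well-defined linear form on $\mathrm{K}_0(\operatorname{mod}B)$, i.e. there is a unique homomorphism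 $\ell_i:\mathrm{K}_0(\operatorname{mod}B)\to\mathbb{Z}$ with $\ell_i(\pi y)=\langle [S_i],y\rangle_a$ for all $y$. -/

import Mathlib

open CategoryTheory CategoryTheory.Limits CategoryTheory.Abelian
open scoped ModuleCat

universe w v u

noncomputable section

namespace TwoCY

/-! ### Finite-dimensional right modules over a `k`-algebra and their Grothendieck groups -/

section Modules

variable (k : Type w) [Field k] (B : Type v) [Ring B] [Algebra k B]

/-- Right `B`-modules are modules over `Bᵐᵒᵖ`; this is the property of having finite
dimension over `k` (acting through `k → B`). -/
def isFD : ObjectProperty (ModuleCat.{v} Bᵐᵒᵖ) := fun M => Module.Finite k M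

/-- The category `mod B` of finite-dimensional right `B`-modules. -/
abbrev FDMod : Type (v + 1) := (isFD k B).FullSubcategory

/-- Isomorphism classes of finite-dimensional right `B`-modules. -/
abbrev IsoClass : Type (v + 1) := Quotient (isIsomorphicSetoid (FDMod k B))

variable {k B}

instance finiteObj (N : FDMod k B) : Module.Finite k N.obj := N.property

/-- The generator attached to a module. -/
def cls (N : FDMod k B) : FreeAbelianGroup (IsoClass k B) :=
  FreeAbelianGroup.of (Quotient.mk (isIsomorphicSetoid (FDMod k B)) N)

lemma finite_of_surjective {M N : ModuleCat.{v} Bᵐᵒᵖ} [Module.Finite k M] (f : M ⟶ N)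
    (hf : Function.Surjective f.hom) : Module.Finite k N :=
  Module.Finite.of_surjective (f.hom.restrictScalars k) hf

lemma finite_of_injective {M N : ModuleCat.{v} Bᵐᵒᵖ} [hN : Module.Finite k N] (f : M ⟶ N)
    (hf : Function.Injective f.hom) : Module.Finite k M :=
  Module.Finite.of_injective (f.hom.restrictScalars k) hf

/-- The direct sum of two finite-dimensional modules. -/
def dsum (N₁ N₂ : FDMod k B) : FDMod k B where
  obj := N₁.obj ⊞ N₂.obj
  property := by
    let φ : (N₁.obj ⊞ N₂.obj : ModuleCat.{v} Bᵐᵒᵖ) →ₗ[k] (N₁.obj × N₂.obj) :=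
      ((biprod.fst : N₁.obj ⊞ N₂.obj ⟶ N₁.obj).hom.restrictScalars k).prod
        ((biprod.snd : N₁.obj ⊞ N₂.obj ⟶ N₂.obj).hom.restrictScalars k)
    refine Module.Finite.of_injective φ ?_
    rw [injective_iff_map_eq_zero]
    intro x hx
    have h1 : (biprod.fst : N₁.obj ⊞ N₂.obj ⟶ N₁.obj).hom x = 0 := congrArg Prod.fst hx
    have h2 : (biprod.snd : N₁.obj ⊞ N₂.obj ⟶ N₂.obj).hom x = 0 := congrArg Prod.snd hx
    have h := congrArg (fun f => f.hom x) (biprod.total (X := N₁.obj) (Y := N₂.obj))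
    simp only [ModuleCat.hom_add, ModuleCat.hom_comp, LinearMap.add_apply,
      LinearMap.comp_apply, ModuleCat.hom_id, LinearMap.id_apply] at h
    rw [h1, h2, map_zero, map_zero, add_zero] at h
    exact h.symm

variable (k B)

/-- The elements `[N₁ ⊕ N₂] - [N₁] - [N₂]`. -/
def splitRel : Set (FreeAbelianGroup (IsoClass k B)) :=
  {x | ∃ N₁ N₂ : FDMod k B, x = cls (dsum N₁ N₂) - cls N₁ - cls N₂}

/-- The elements `[Y] - [X] - [Z]` for all short exact sequences `0 → X → Y → Z → 0`. -/
def exactRel : Set (FreeAbelianGroup (IsoClass k B)) :=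
  {x | ∃ (X Y Z : FDMod k B) (f : X.obj ⟶ Y.obj) (g : Y.obj ⟶ Z.obj) (h : f ≫ g = 0),
    (ShortComplex.mk f g h).ShortExact ∧ x = cls Y - cls X - cls Z}

/-- The split Grothendieck group of `mod B`. -/
abbrev K0sp : Type (v + 1) :=
  FreeAbelianGroup (IsoClass k B) ⧸ AddSubgroup.closure (splitRel k B)

/-- The Grothendieck group of `mod B`. -/
abbrev K0 : Type (v + 1) :=
  FreeAbelianGroup (IsoClass k B) ⧸ AddSubgroup.closure (exactRel k B)

lemma splitRel_subset_exactRel : splitRel k B ⊆ exactRel k B := by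
  rintro x ⟨N₁, N₂, rfl⟩
  exact ⟨N₁, dsum N₁ N₂, N₂, biprod.inl, biprod.snd, biprod.inl_snd,
    (ShortComplex.Splitting.ofHasBinaryBiproduct N₁.obj N₂.obj).shortExact, rfl⟩

/-- The canonical surjection from the split Grothendieck group to the Grothendieck group. -/
def toK0 : K0sp k B →+ K0 k B :=
  QuotientAddGroup.map _ _ (AddMonoidHom.id _)
    (AddSubgroup.closure_mono (splitRel_subset_exactRel k B))

variable {k B}

/-- The class of a module in the split Grothendieck group. -/
def K0sp.mk (N : FDMod k B) : K0sp k B := QuotientAddGroup.mk (cls N)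

/-- The universal property of the split Grothendieck group. -/
def K0sp.lift {A : Type*} [AddCommGroup A] (f : FDMod k B → A)
    (hiso : ∀ M N : FDMod k B, Nonempty (M ≅ N) → f M = f N)
    (hadd : ∀ M N : FDMod k B, f (dsum M N) = f M + f N) : K0sp k B →+ A :=
  QuotientAddGroup.lift _
    (FreeAbelianGroup.lift
      (Quotient.lift (s := isIsomorphicSetoid (FDMod k B)) f hiso)) (by
    rw [AddSubgroup.closure_le]
    rintro x ⟨N₁, N₂, rfl⟩
    have h : f (dsum N₁ N₂) - f N₁ - f N₂ = 0 := by
      rw [hadd]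
      abel
    rw [SetLike.mem_coe, AddMonoidHom.mem_ker]
    simp only [cls, map_sub, FreeAbelianGroup.lift_apply_of]
    exact h)

lemma K0sp.lift_mk {A : Type*} [AddCommGroup A] (f : FDMod k B → A)
    (hiso : ∀ M N : FDMod k B, Nonempty (M ≅ N) → f M = f N)
    (hadd : ∀ M N : FDMod k B, f (dsum M N) = f M + f N) (N : FDMod k B) :
    K0sp.lift f hiso hadd (K0sp.mk N) = f N := by
  simp only [K0sp.lift, K0sp.mk, cls, QuotientAddGroup.lift_mk, FreeAbelianGroup.lift_apply_of]
  rfl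

lemma K0sp.hom_ext {A : Type*} [AddCommGroup A] {f g : K0sp k B →+ A}
    (h : ∀ N, f (K0sp.mk N) = g (K0sp.mk N)) : f = g := by
  apply QuotientAddGroup.addMonoidHom_ext
  apply FreeAbelianGroup.lift_ext
  rintro ⟨N⟩
  exact h N

/-! ### The form `dim Hom - dim Ext¹` -/

instance finiteHom (M N : FDMod k B) : Module.Finite k (M.obj ⟶ N.obj) := by
  let φ : (M.obj ⟶ N.obj) →ₗ[k] (M.obj →ₗ[k] N.obj) :=
    { toFun := fun f => f.hom.restrictScalars k
      map_add' := fun _ _ => rfl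
      map_smul' := fun _ _ => rfl }
  refine Module.Finite.of_injective φ ?_
  intro f g h
  ext x
  exact LinearMap.congr_fun h x

instance finiteExtZero (M N : FDMod k B) : Module.Finite k (Ext M.obj N.obj 0) :=
  Module.Finite.equiv (Ext.linearEquiv₀ (R := k) (X := M.obj) (Y := N.obj)).symm

lemma isFD_of_finite [Module.Finite k B] (M : ModuleCat.{v} Bᵐᵒᵖ)
    (_ : Module.Finite Bᵐᵒᵖ M) : isFD k B M := by
  have : Module.Finite k Bᵐᵒᵖ := Module.Finite.equiv (MulOpposite.opLinearEquiv k)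
  exact Module.Finite.trans Bᵐᵒᵖ M

instance finiteExt [Module.Finite k B] (M N : FDMod k B) :
    Module.Finite k (Ext M.obj N.obj 1) := by
  have : Module.Finite Bᵐᵒᵖ M.obj := Module.Finite.of_restrictScalars_finite k _ _
  obtain ⟨n, p, hp⟩ := Module.Finite.exists_fin' Bᵐᵒᵖ M.obj
  let P : ModuleCat.{v} Bᵐᵒᵖ := ModuleCat.of Bᵐᵒᵖ (Fin n → Bᵐᵒᵖ)
  have hP : Module.Finite Bᵐᵒᵖ P := inferInstanceAs (Module.Finite Bᵐᵒᵖ (Fin n → Bᵐᵒᵖ))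
  have : Projective P := ModuleCat.projective_of_free (Pi.basisFun Bᵐᵒᵖ (Fin n))
  let q : P ⟶ M.obj := ModuleCat.ofHom p
  have : Epi q := (ModuleCat.epi_iff_surjective q).2 hp
  let S := ShortComplex.mk _ _ (kernel.condition q)
  have hS : S.ShortExact :=
    { exact := ShortComplex.exact_of_f_is_kernel _ (kernelIsKernel q) }
  let K : FDMod k B := ⟨kernel q,
    finite_of_injective (hN := isFD_of_finite P hP) (kernel.ι q)
      ((ModuleCat.mono_iff_injective _).1 inferInstance)⟩
  have : Module.Finite k (Ext K.obj N.obj 0) := finiteExtZero K N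
  refine Module.Finite.of_surjective
    (Ext.precompOfLinear hS.extClass k N.obj (a := 0) (b := 1) rfl) ?_
  intro x
  exact Ext.contravariant_sequence_exact₃ hS N.obj x (Ext.eq_zero_of_projective _) rfl

/-- `⟨N, N'⟩ = dim Hom_B(N, N') - dim Ext¹_B(N, N')`. -/
def pairing (N N' : FDMod k B) : ℤ :=
  (Module.finrank k (N.obj ⟶ N'.obj) : ℤ) - (Module.finrank k (Ext N.obj N'.obj 1) : ℤ)

lemma finrank_ext_dsum_left (n : ℕ) (M₁ M₂ N : FDMod k B)
    [Module.Finite k (Ext M₁.obj N.obj n)] [Module.Finite k (Ext M₂.obj N.obj n)] :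
    Module.finrank k (Ext (dsum M₁ M₂).obj N.obj n) =
      Module.finrank k (Ext M₁.obj N.obj n) + Module.finrank k (Ext M₂.obj N.obj n) := by
  rw [← Module.finrank_prod]
  exact LinearEquiv.finrank_eq
    { (Ext.biprodAddEquiv : Ext (M₁.obj ⊞ M₂.obj) N.obj n ≃+ _) with
      map_smul' := fun r x => Prod.ext
        (Ext.comp_smul _ _ (zero_add n) _) (Ext.comp_smul _ _ (zero_add n) _) }

lemma finrank_ext_dsum_right (n : ℕ) (M N₁ N₂ : FDMod k B)
    [Module.Finite k (Ext M.obj N₁.obj n)] [Module.Finite k (Ext M.obj N₂.obj n)] :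
    Module.finrank k (Ext M.obj (dsum N₁ N₂).obj n) =
      Module.finrank k (Ext M.obj N₁.obj n) + Module.finrank k (Ext M.obj N₂.obj n) := by
  rw [← Module.finrank_prod]
  exact LinearEquiv.finrank_eq
    { (Ext.addEquivBiprod : Ext M.obj (N₁.obj ⊞ N₂.obj) n ≃+ _) with
      map_smul' := fun r x => Prod.ext
        (Ext.smul_comp _ _ (add_zero n) _) (Ext.smul_comp _ _ (add_zero n) _) }

lemma pairing_eq (N N' : FDMod k B) :
    pairing N N' = (Module.finrank k (Ext N.obj N'.obj 0) : ℤ) -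
      (Module.finrank k (Ext N.obj N'.obj 1) : ℤ) := by
  rw [pairing, (Ext.linearEquiv₀ (R := k) (X := N.obj) (Y := N'.obj)).finrank_eq]

lemma finrank_ext_congr (n : ℕ) {M M' N N' : FDMod k B} (e : M ≅ M') (e' : N ≅ N') :
    Module.finrank k (Ext M.obj N.obj n) = Module.finrank k (Ext M'.obj N'.obj n) := by
  have a : M.obj ≅ M'.obj := (isFD k B).ι.mapIso e
  have b : N.obj ≅ N'.obj := (isFD k B).ι.mapIso e'
  refine LinearEquiv.finrank_eq (LinearEquiv.ofLinearMap
    (Ext.precompOfLinear (Ext.mk₀ a.inv) k N'.obj (zero_add n) ∘ₗ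
      Ext.postcompOfLinear (Ext.mk₀ b.hom) k M.obj (add_zero n))
    (Ext.precompOfLinear (Ext.mk₀ a.hom) k N.obj (zero_add n) ∘ₗ
      Ext.postcompOfLinear (Ext.mk₀ b.inv) k M'.obj (add_zero n)) ?_ ?_)
  · ext x
    simp
  · ext x
    simp

lemma pairing_congr {M M' N N' : FDMod k B} (e : M ≅ M') (e' : N ≅ N') :
    pairing M N = pairing M' N' := by
  rw [pairing_eq, pairing_eq, finrank_ext_congr 0 e e', finrank_ext_congr 1 e e']

variable (k B)

/-- The bilinear form `⟨ , ⟩` on the split Grothendieck group. -/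
def form [Module.Finite k B] : K0sp k B →+ K0sp k B →+ ℤ :=
  K0sp.lift
    (fun N => K0sp.lift (fun N' => pairing N N')
      (fun _ _ ⟨e⟩ => pairing_congr (Iso.refl _) e)
      (fun N₁ N₂ => by
        simp only [pairing_eq, finrank_ext_dsum_right]
        push_cast
        ring))
    (fun _ _ ⟨e⟩ => K0sp.hom_ext fun N => by
      simp only [K0sp.lift_mk]
      exact pairing_congr e (Iso.refl _))
    (fun M₁ M₂ => K0sp.hom_ext fun N => by
      simp only [K0sp.lift_mk, AddMonoidHom.add_apply, pairing_eq, finrank_ext_dsum_left]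
      push_cast
      ring)

/-- The antisymmetric bilinear form `⟨x, y⟩ₐ = ⟨x, y⟩ - ⟨y, x⟩` on the split Grothendieck
group. -/
def formA [Module.Finite k B] : K0sp k B →+ K0sp k B →+ ℤ :=
  form k B - (form k B).flip

variable {k B}

lemma formA_mk [Module.Finite k B] (N N' : FDMod k B) :
    formA k B (K0sp.mk N) (K0sp.mk N') = pairing N N' - pairing N' N := by
  simp [formA, form, K0sp.lift_mk]

/-- The top `M / rad M` of a module, `rad M` being the intersection of the maximal
submodules of `M`. -/
def top (M : FDMod k B) : FDMod k B where
  obj := ModuleCat.of Bᵐᵒᵖ (M.obj ⧸ Module.jacobson Bᵐᵒᵖ M.obj)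
  property := finite_of_surjective
    (ModuleCat.ofHom (Module.jacobson Bᵐᵒᵖ M.obj).mkQ) (Submodule.mkQ_surjective _)

end Modules

/-! ### 2-Calabi--Yau triangulated categories and cluster-tilting objects -/

section Category

variable (k : Type w) [Field k] {C : Type u} [Category.{v} C] [Preadditive C] [Linear k C]

section

variable [HasShift C ℤ]

variable (C) in
/-- There are isomorphisms `C(X, ΣY) ≃ D C(Y, ΣX)`, natural in both `X` and `Y`. -/
def IsTwoCalabiYau : Prop :=
  ∃ φ : ∀ X Y : C, (X ⟶ Y⟦(1 : ℤ)⟧) ≃ₗ[k] Module.Dual k (Y ⟶ X⟦(1 : ℤ)⟧),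
    ∀ {X X' Y Y' : C} (f : X' ⟶ X) (h : Y ⟶ Y') (a : X ⟶ Y⟦(1 : ℤ)⟧)
      (b : Y' ⟶ X'⟦(1 : ℤ)⟧),
      φ X' Y' (f ≫ a ≫ h⟦(1 : ℤ)⟧') b = φ X Y a (h ≫ b ≫ f⟦(1 : ℤ)⟧')

/-- `X` is a direct summand of `Y`. -/
def IsSummand [HasBinaryBiproducts C] (X Y : C) : Prop :=
  ∃ Z : C, Nonempty (Y ≅ X ⊞ Z)

/-- `X` lies in `add T`: it is a direct summand of a finite direct sum of copies of `T`. -/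
def InAdd [HasBinaryBiproducts C] [HasFiniteBiproducts C] (T X : C) : Prop :=
  ∃ n : ℕ, IsSummand X (⨁ fun _ : Fin n => T)

/-- `T` is a cluster-tilting object. -/
structure IsClusterTilting [HasBinaryBiproducts C] [HasFiniteBiproducts C] (T : C) : Prop where
  rigid : ∀ f : T ⟶ T⟦(1 : ℤ)⟧, f = 0
  mem_add : ∀ X : C, (∀ f : X ⟶ T⟦(1 : ℤ)⟧, f = 0) → InAdd T X

end

variable [∀ X Y : C, Module.Finite k (X ⟶ Y)]

instance finiteEnd (T : C) : Module.Finite k (End T) :=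
  inferInstanceAs (Module.Finite k (T ⟶ T))

/-- The right `End T`-module `F X = C(T, X)`, with `End T` acting by precomposition. -/
def F (T X : C) : FDMod k (End T) where
  obj := (preadditiveCoyonedaObj T).obj X
  property := by
    let φ : (T ⟶ X) →ₗ[k] (preadditiveCoyonedaObj T).obj X :=
      { toFun := fun f => f
        map_add' := fun _ _ => rfl
        map_smul' := fun r f => by
          change r • f = (r • 𝟙 T) ≫ f
          rw [Linear.smul_comp, Category.id_comp] }
    exact Module.Finite.of_surjective φ fun f => ⟨f, rfl⟩

end Category

end TwoCY

end

noncomputable section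

namespace TwoCY

open Pretriangulated

/-! ### Linear algebra -/

section LinearAlgebra

variable {k V W : Type*} [Field k] [AddCommGroup V] [Module k V] [AddCommGroup W] [Module k W]

/-- The subspace of `W` orthogonal to `A ≤ V` under a pairing `V → W*`. -/
def orth (φ : V ≃ₗ[k] Module.Dual k W) (A : Submodule k V) : Submodule k W :=
  (A.map φ.toLinearMap).dualCoannihilator

lemma mem_orth {φ : V ≃ₗ[k] Module.Dual k W} {A : Submodule k V} {b : W} :
    b ∈ orth φ A ↔ ∀ a ∈ A, φ a b = 0 := by
  rw [orth, Submodule.mem_dualCoannihilator]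
  exact ⟨fun h a ha => h _ ⟨a, ha, rfl⟩, fun h _ ⟨a, ha, e⟩ => e ▸ h a ha⟩

lemma orth_sup (φ : V ≃ₗ[k] Module.Dual k W) (A A' : Submodule k V) :
    orth φ (A ⊔ A') = orth φ A ⊓ orth φ A' := by
  simp [orth, Submodule.map_sup, Submodule.dualCoannihilator_sup_eq]

lemma finrank_add_finrank_orth [Module.Finite k V] [Module.Finite k W]
    (φ : V ≃ₗ[k] Module.Dual k W) (A : Submodule k V) :
    Module.finrank k A + Module.finrank k (orth φ A) = Module.finrank k V := by
  rw [orth, φ.finrank_eq, Subspace.dual_finrank_eq,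
    ← Subspace.finrank_add_finrank_dualCoannihilator_eq (A.map φ.toLinearMap)]
  congr 1
  exact (φ.submoduleMap A).finrank_eq

end LinearAlgebra

/-! ### Retracts of sums of copies of an object -/

section AddRetract

variable {C : Type u} [Category.{v} C] [Preadditive C]

/-- `P` is a retract of a finite sum of copies of `U`, expressed through the components of the
section and of the retraction. -/
def IsAddRetract (U P : C) : Prop :=
  ∃ (n : ℕ) (p : Fin n → (P ⟶ U)) (q : Fin n → (U ⟶ P)), ∑ i, p i ≫ q i = 𝟙 P

lemma IsAddRetract.comp_eq_zero {U P X Y : C} (h : IsAddRetract U P) {a : X ⟶ Y}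
    (ha : ∀ t : U ⟶ X, t ≫ a = 0) (s : P ⟶ X) : s ≫ a = 0 := by
  obtain ⟨n, p, q, hpq⟩ := h
  rw [← Category.id_comp (s ≫ a), ← hpq, Preadditive.sum_comp]
  refine Finset.sum_eq_zero fun i _ => ?_
  rw [Category.assoc, ← Category.assoc (q i), ha, comp_zero]

lemma IsAddRetract.hom_eq_zero {U P X : C} (h : IsAddRetract U P)
    (hX : ∀ t : X ⟶ U, t = 0) (s : X ⟶ P) : s = 0 := by
  obtain ⟨n, p, q, hpq⟩ := h
  rw [← Category.comp_id s, ← hpq, Preadditive.comp_sum]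
  refine Finset.sum_eq_zero fun i _ => ?_
  rw [← Category.assoc, hX (s ≫ p i), zero_comp]

lemma IsAddRetract.map {U P : C} (h : IsAddRetract U P) (G : C ⥤ C) [G.Additive] :
    IsAddRetract (G.obj U) (G.obj P) := by
  obtain ⟨n, p, q, hpq⟩ := h
  refine ⟨n, fun i => G.map (p i), fun i => G.map (q i), ?_⟩
  simp only [← G.map_comp, ← G.map_sum, hpq, G.map_id]

lemma IsAddRetract.of_retract {U P Q : C} (h : IsAddRetract U P) (i : Q ⟶ P) (r : P ⟶ Q)
    (hir : i ≫ r = 𝟙 Q) : IsAddRetract U Q := by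
  obtain ⟨n, p, q, hpq⟩ := h
  refine ⟨n, fun j => i ≫ p j, fun j => q j ≫ r, ?_⟩
  have : ∑ j, (i ≫ p j) ≫ q j ≫ r = i ≫ (∑ j, p j ≫ q j) ≫ r := by
    simp only [Preadditive.comp_sum, Preadditive.sum_comp, Category.assoc]
  rw [this, hpq, Category.id_comp, hir]

lemma isAddRetract_biproduct [HasFiniteBiproducts C] (U : C) (n : ℕ) :
    IsAddRetract U (⨁ fun _ : Fin n => U) :=
  ⟨n, biproduct.π _, biproduct.ι _, biproduct.total⟩

lemma InAdd.isAddRetract [HasShift C ℤ] [HasBinaryBiproducts C] [HasFiniteBiproducts C] {T X : C}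
    (h : InAdd T X) : IsAddRetract T X := by
  obtain ⟨n, Z, ⟨e⟩⟩ := h
  exact (isAddRetract_biproduct T n).of_retract (biprod.inl ≫ e.inv) (e.hom ≫ biprod.fst) (by simp)

end AddRetract

/-! ### Approximation triangles -/

section Approx

variable (k : Type w) [Field k] {C : Type u} [Category.{v} C] [Preadditive C] [Linear k C] (U : C)

/-- The morphisms `X ⟶ Z` killed by `C(U, -)`. -/
def ann (X Z : C) : Submodule k (X ⟶ Z) where
  carrier := {a | ∀ t : U ⟶ X, t ≫ a = 0}
  add_mem' ha hb t := by rw [Preadditive.comp_add, ha t, hb t, add_zero]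
  zero_mem' t := comp_zero
  smul_mem' r a ha t := by rw [Linear.comp_smul, ha t, smul_zero]

variable {k U}

variable [HasShift C ℤ]

/-- A variant of `IsClusterTilting` that is visibly stable under shifts. -/
structure IsTilting (U : C) : Prop where
  rigid : ∀ f : U ⟶ U⟦(1 : ℤ)⟧, f = 0
  mem : ∀ X : C, (∀ f : X ⟶ U⟦(1 : ℤ)⟧, f = 0) → IsAddRetract U X

lemma IsClusterTilting.isTilting [HasBinaryBiproducts C] [HasFiniteBiproducts C] {T : C}
    (h : IsClusterTilting T) : IsTilting T where
  rigid := h.rigid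
  mem X hX := (h.mem_add X hX).isAddRetract

lemma IsTwoCalabiYau.hom_eq_zero (hCY : IsTwoCalabiYau k C) {X Y : C}
    (h : ∀ f : X ⟶ Y⟦(1 : ℤ)⟧, f = 0) (f : Y ⟶ X⟦(1 : ℤ)⟧) : f = 0 := by
  obtain ⟨φ, -⟩ := hCY
  apply (φ Y X).injective
  ext g
  rw [h g, map_zero, map_zero]

variable [∀ n : ℤ, (shiftFunctor C n).Additive]

lemma IsTilting.shift (h : IsTilting U) : IsTilting (U⟦(1 : ℤ)⟧) where
  rigid f := by
    obtain ⟨g, rfl⟩ := (shiftFunctor C (1 : ℤ)).map_surjective f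
    rw [h.rigid g, Functor.map_zero]
  mem X hX := by
    let e : (X⟦(-1 : ℤ)⟧)⟦(1 : ℤ)⟧ ≅ X := (shiftFunctorCompIsoId C (-1 : ℤ) 1 (by simp)).app X
    have h' : IsAddRetract U (X⟦(-1 : ℤ)⟧) := h.mem _ fun f => by
      apply (shiftFunctor C (1 : ℤ)).map_injective
      rw [Functor.map_zero, ← cancel_epi e.inv, hX (e.inv ≫ _), comp_zero]
    exact (h'.map (shiftFunctor C (1 : ℤ))).of_retract e.inv e.hom e.inv_hom_id

lemma finrank_hom_shift [(shiftFunctor C (1 : ℤ)).Linear k] (X Y : C) :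
    Module.finrank k (X⟦(1 : ℤ)⟧ ⟶ Y⟦(1 : ℤ)⟧) = Module.finrank k (X ⟶ Y) :=
  (LinearEquiv.ofBijective ((shiftFunctor C (1 : ℤ)).mapLinearMap k)
    ⟨(shiftFunctor C (1 : ℤ)).map_injective,
      (shiftFunctor C (1 : ℤ)).map_surjective⟩).finrank_eq.symm

lemma finrank_ann_shift [(shiftFunctor C (1 : ℤ)).Linear k] (X Y : C) :
    Module.finrank k (ann k (U⟦(1 : ℤ)⟧) (X⟦(1 : ℤ)⟧) (Y⟦(1 : ℤ)⟧)) =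
      Module.finrank k (ann k U X Y) := by
  let S := shiftFunctor C (1 : ℤ)
  have h : (ann k U X Y).map (S.mapLinearMap k) =
      ann k (U⟦(1 : ℤ)⟧) (X⟦(1 : ℤ)⟧) (Y⟦(1 : ℤ)⟧) := by
    ext a
    constructor
    · rintro ⟨a, ha, rfl⟩ t
      obtain ⟨t, rfl⟩ := S.map_surjective t
      change S.map t ≫ S.map a = 0
      rw [← S.map_comp, ha t, S.map_zero]
    · intro ha
      obtain ⟨a, rfl⟩ := S.map_surjective a
      refine ⟨a, fun t => S.map_injective ?_, rfl⟩
      rw [S.map_comp, ha (S.map t), S.map_zero]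
  rw [← h]
  exact (Submodule.equivMapOfInjective _ S.map_injective _).finrank_eq.symm

variable [HasZeroObject C] [Pretriangulated C]

/-- A distinguished triangle `P₁ ⟶ P₀ ⟶ X ⟶ ΣP₁` with `P₁` and `P₀` in `add U`. -/
structure Approx (U X : C) where
  /-- the first term -/
  P₁ : C
  /-- the second term -/
  P₀ : C
  /-- the first morphism -/
  f : P₁ ⟶ P₀
  /-- the second morphism -/
  g : P₀ ⟶ X
  /-- the third morphism -/
  δ : X ⟶ P₁⟦(1 : ℤ)⟧
  dist : Triangle.mk f g δ ∈ distTriang C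
  mem₁ : IsAddRetract U P₁
  mem₀ : IsAddRetract U P₀

lemma IsTilting.exists_approx [∀ X Y : C, Module.Finite k (X ⟶ Y)] (hCY : IsTwoCalabiYau k C)
    (hU : IsTilting U) (X : C) : Nonempty (Approx U X) := by
  obtain ⟨n, s, hs⟩ := Module.Finite.exists_fin (R := k) (M := U ⟶ X)
  let g : (⨁ fun _ : Fin n => U) ⟶ X := biproduct.desc s
  have hg : ∀ t : U ⟶ X, ∃ t', t = t' ≫ g := fun t => by
    have ht : t ∈ Submodule.span k (Set.range s) := hs ▸ Submodule.mem_top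
    induction ht using Submodule.span_induction with
    | mem t ht =>
      obtain ⟨i, rfl⟩ := ht
      exact ⟨biproduct.ι (fun _ : Fin n => U) i, (biproduct.ι_desc _ _).symm⟩
    | zero => exact ⟨0, zero_comp.symm⟩
    | add a b _ _ ha hb =>
      obtain ⟨a', rfl⟩ := ha
      obtain ⟨b', rfl⟩ := hb
      exact ⟨a' + b', (Preadditive.add_comp _ _ _ _ _ _).symm⟩
    | smul r a _ ha =>
      obtain ⟨a', rfl⟩ := ha
      exact ⟨r • a', (Linear.smul_comp _ _ _ _ _ _).symm⟩
  obtain ⟨P₁, f, δ, dist⟩ := distinguished_cocone_triangle₁ g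
  have hgδ : g ≫ δ = 0 := comp_distTriang_mor_zero₂₃ _ dist
  have hP₁ : ∀ a : U ⟶ P₁⟦(1 : ℤ)⟧, a = 0 := fun a => by
    obtain ⟨b, hb⟩ := Triangle.coyoneda_exact₁ _ dist a
      (((isAddRetract_biproduct U n).map (shiftFunctor C (1 : ℤ))).hom_eq_zero hU.rigid _)
    obtain ⟨b', rfl⟩ := hg b
    rw [hb]
    change (b' ≫ g) ≫ δ = 0
    rw [Category.assoc, hgδ, comp_zero]
  exact ⟨⟨P₁, _, f, g, δ, dist, hU.mem _ (hCY.hom_eq_zero hP₁), isAddRetract_biproduct U n⟩⟩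

namespace Approx

variable {X : C} (A : Approx U X)

lemma comp_f_g : A.f ≫ A.g = 0 := comp_distTriang_mor_zero₁₂ _ A.dist

lemma comp_δ_f : A.δ ≫ A.f⟦(1 : ℤ)⟧' = 0 := comp_distTriang_mor_zero₃₁ _ A.dist

variable {A} in
lemma comp_δ_eq_zero (hU : ∀ f : U ⟶ U⟦(1 : ℤ)⟧, f = 0) (t : U ⟶ X) : t ≫ A.δ = 0 :=
  (A.mem₁.map (shiftFunctor C (1 : ℤ))).hom_eq_zero hU _

lemma exists_lift (hU : ∀ f : U ⟶ U⟦(1 : ℤ)⟧, f = 0) (t : U ⟶ X) : ∃ t', t' ≫ A.g = t := by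
  obtain ⟨t', ht⟩ := Triangle.coyoneda_exact₃ _ A.dist t (comp_δ_eq_zero hU t)
  exact ⟨t', ht.symm⟩

lemma mem_ann_iff (hU : ∀ f : U ⟶ U⟦(1 : ℤ)⟧, f = 0) {Z : C} (a : X ⟶ Z) :
    a ∈ ann k U X Z ↔ A.g ≫ a = 0 := by
  refine ⟨fun h => A.mem₀.comp_eq_zero h A.g, fun h t => ?_⟩
  obtain ⟨t', rfl⟩ := A.exists_lift hU t
  rw [Category.assoc, h, comp_zero]

lemma δ_comp_mem_ann (hU : ∀ f : U ⟶ U⟦(1 : ℤ)⟧, f = 0) {Y : C} (u : A.P₁ ⟶ Y) :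
    A.δ ≫ u⟦(1 : ℤ)⟧' ∈ ann k U X (Y⟦(1 : ℤ)⟧) := fun t => by
  rw [← Category.assoc, comp_δ_eq_zero hU, zero_comp]

lemma exists_of_mem_ann (hU : ∀ f : U ⟶ U⟦(1 : ℤ)⟧, f = 0) {Y : C} {a : X ⟶ Y⟦(1 : ℤ)⟧}
    (ha : a ∈ ann k U X (Y⟦(1 : ℤ)⟧)) : ∃ u : A.P₁ ⟶ Y, A.δ ≫ u⟦(1 : ℤ)⟧' = a := by
  obtain ⟨b, hb⟩ := Triangle.yoneda_exact₃ _ A.dist a ((A.mem_ann_iff hU a).1 ha)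
  obtain ⟨u, rfl⟩ := (shiftFunctor C (1 : ℤ)).map_surjective b
  exact ⟨u, hb.symm⟩

lemma δ_comp_eq_zero_iff {Y : C} (u : A.P₁ ⟶ Y) :
    A.δ ≫ u⟦(1 : ℤ)⟧' = 0 ↔ ∃ u₀ : A.P₀ ⟶ Y, A.f ≫ u₀ = u := by
  constructor
  · intro h
    obtain ⟨b, hb⟩ : ∃ b : A.P₀⟦(1 : ℤ)⟧ ⟶ Y⟦(1 : ℤ)⟧, u⟦(1 : ℤ)⟧' = (-A.f⟦(1 : ℤ)⟧') ≫ b :=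
      Triangle.yoneda_exact₃ _ (rot_of_distTriang _ A.dist) (u⟦(1 : ℤ)⟧') h
    obtain ⟨u₀, rfl⟩ := (shiftFunctor C (1 : ℤ)).map_surjective b
    refine ⟨-u₀, (shiftFunctor C (1 : ℤ)).map_injective ?_⟩
    rw [hb, Functor.map_comp, Functor.map_neg, Preadditive.comp_neg, Preadditive.neg_comp]
  · rintro ⟨u₀, rfl⟩
    rw [Functor.map_comp, ← Category.assoc, A.comp_δ_f, zero_comp]

lemma exists_factor {Y : C} {u : A.P₀ ⟶ Y} (hu : A.f ≫ u = 0) : ∃ a : X ⟶ Y, A.g ≫ a = u := by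
  obtain ⟨a, ha⟩ := Triangle.yoneda_exact₂ _ A.dist u hu
  exact ⟨a, ha.symm⟩

lemma mem_ann_shift_iff {Y : C} (u : A.P₁ ⟶ Y) :
    A.δ ≫ u⟦(1 : ℤ)⟧' ∈ ann k (U⟦(1 : ℤ)⟧) X (Y⟦(1 : ℤ)⟧) ↔
      ∀ t : U ⟶ A.P₁, t ≫ A.f = 0 → t ≫ u = 0 := by
  constructor
  · intro h t ht
    obtain ⟨s, hs⟩ : ∃ s : U⟦(1 : ℤ)⟧ ⟶ X, t⟦(1 : ℤ)⟧' = s ≫ A.δ :=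
      Triangle.coyoneda_exact₁ _ A.dist (t⟦(1 : ℤ)⟧') (by
        change t⟦(1 : ℤ)⟧' ≫ A.f⟦(1 : ℤ)⟧' = 0
        rw [← Functor.map_comp, ht, Functor.map_zero])
    apply (shiftFunctor C (1 : ℤ)).map_injective
    rw [Functor.map_comp, hs, Category.assoc, h s, Functor.map_zero]
  · intro h s
    obtain ⟨t, ht⟩ := (shiftFunctor C (1 : ℤ)).map_surjective (s ≫ A.δ)
    have : t ≫ A.f = 0 := (shiftFunctor C (1 : ℤ)).map_injective (by
      rw [Functor.map_comp, ht, Category.assoc, A.comp_δ_f, comp_zero, Functor.map_zero])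
    rw [← Category.assoc, ← ht, ← Functor.map_comp, h t this, Functor.map_zero]

/-- Composition with `δ`, as a map `C(P₁, Y) → C(X, ΣY)`. -/
def connecting [(shiftFunctor C (1 : ℤ)).Linear k] (Y : C) :
    (A.P₁ ⟶ Y) →ₗ[k] (X ⟶ Y⟦(1 : ℤ)⟧) where
  toFun u := A.δ ≫ u⟦(1 : ℤ)⟧'
  map_add' u u' := by rw [Functor.map_add, Preadditive.comp_add]
  map_smul' r u := by rw [Functor.map_smul, Linear.comp_smul, RingHom.id_apply]

lemma connecting_apply [(shiftFunctor C (1 : ℤ)).Linear k] {Y : C} (u : A.P₁ ⟶ Y) :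
    A.connecting (k := k) Y u = A.δ ≫ u⟦(1 : ℤ)⟧' := rfl

/-- The Euler characteristic of
`0 → ann(X, Y) → C(X, Y) → C(P₀, Y) → C(P₁, Y) → ann(X, ΣY) → 0`. -/
lemma finrank_ann [∀ X Y : C, Module.Finite k (X ⟶ Y)] [(shiftFunctor C (1 : ℤ)).Linear k]
    (hU : ∀ f : U ⟶ U⟦(1 : ℤ)⟧, f = 0) (Y : C) :
    Module.finrank k (X ⟶ Y) + Module.finrank k (A.P₁ ⟶ Y) =
      Module.finrank k (ann k U X Y) + Module.finrank k (A.P₀ ⟶ Y) +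
        Module.finrank k (ann k U X (Y⟦(1 : ℤ)⟧)) := by
  have h₁ := (Linear.leftComp k Y A.g).finrank_range_add_finrank_ker
  have h₂ := (Linear.leftComp k Y A.f).finrank_range_add_finrank_ker
  have h₃ := (A.connecting (k := k) Y).finrank_range_add_finrank_ker
  have e₁ : LinearMap.ker (Linear.leftComp k Y A.g) = ann k U X Y := by
    ext a
    exact (A.mem_ann_iff hU a).symm
  have e₂ : LinearMap.range (Linear.leftComp k Y A.g) =
      LinearMap.ker (Linear.leftComp k Y A.f) := by
    ext u
    constructor
    · rintro ⟨a, rfl⟩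
      change A.f ≫ A.g ≫ a = 0
      rw [← Category.assoc, A.comp_f_g, zero_comp]
    · exact fun h => A.exists_factor h
  have e₃ : LinearMap.range (Linear.leftComp k Y A.f) = LinearMap.ker (A.connecting (k := k) Y) := by
    ext u
    exact (A.δ_comp_eq_zero_iff u).symm
  have e₄ : LinearMap.range (A.connecting (k := k) Y) = ann k U X (Y⟦(1 : ℤ)⟧) := by
    ext a
    constructor
    · rintro ⟨u, rfl⟩
      exact A.δ_comp_mem_ann hU u
    · exact fun h => A.exists_of_mem_ann hU h
  rw [e₁, e₂] at h₁
  rw [e₃] at h₂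
  rw [e₄] at h₃
  omega

/-- Under Calabi-Yau duality the orthogonal of `ann(X, ΣY)` is `ann(Y, ΣX)`. -/
lemma orth_ann (A : Approx U X) (hU : ∀ f : U ⟶ U⟦(1 : ℤ)⟧, f = 0)
    (φ : ∀ X Y : C, (X ⟶ Y⟦(1 : ℤ)⟧) ≃ₗ[k] Module.Dual k (Y ⟶ X⟦(1 : ℤ)⟧))
    (hφ : ∀ {X X' Y Y' : C} (f : X' ⟶ X) (h : Y ⟶ Y') (a : X ⟶ Y⟦(1 : ℤ)⟧)
      (b : Y' ⟶ X'⟦(1 : ℤ)⟧),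
      φ X' Y' (f ≫ a ≫ h⟦(1 : ℤ)⟧') b = φ X Y a (h ≫ b ≫ f⟦(1 : ℤ)⟧')) (Y : C) :
    orth (φ X Y) (ann k U X (Y⟦(1 : ℤ)⟧)) = ann k U Y (X⟦(1 : ℤ)⟧) := by
  have hφ' : ∀ {Y Y' : C} (h : Y ⟶ Y') (a : X ⟶ Y⟦(1 : ℤ)⟧) (b : Y' ⟶ X⟦(1 : ℤ)⟧),
      φ X Y' (a ≫ h⟦(1 : ℤ)⟧') b = φ X Y a (h ≫ b) := fun h a b => by
    simpa using hφ (𝟙 X) h a b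
  ext b
  rw [mem_orth]
  constructor
  · intro h t
    rw [← Module.forall_dual_apply_eq_zero_iff k]
    intro ψ
    obtain ⟨c, rfl⟩ := (φ X U).surjective ψ
    rw [← hφ']
    refine h _ fun s => ?_
    rw [← Category.assoc, hU (s ≫ c), zero_comp]
  · intro h a ha
    obtain ⟨s, rfl⟩ := A.exists_of_mem_ann hU ha
    rw [hφ', A.mem₁.comp_eq_zero h, map_zero]

end Approx

end Approx

/-! ### Homs and extensions out of projective presentations -/

section Modules

variable {k : Type w} [Field k] {B : Type v} [Ring B] [Algebra k B]

lemma finrank_hom_of_projective {P : FDMod k B} [Projective P.obj] {X Y Z : FDMod k B}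
    {f : X.obj ⟶ Y.obj} {g : Y.obj ⟶ Z.obj} {h : f ≫ g = 0}
    (hS : (ShortComplex.mk f g h).ShortExact) :
    Module.finrank k (P.obj ⟶ Y.obj) =
      Module.finrank k (P.obj ⟶ X.obj) + Module.finrank k (P.obj ⟶ Z.obj) := by
  have : Mono f := hS.mono_f
  have : Epi g := hS.epi_g
  have h₁ := (Linear.rightComp k P.obj g).finrank_range_add_finrank_ker
  have e₁ : LinearMap.range (Linear.rightComp k P.obj g) = ⊤ :=
    LinearMap.range_eq_top.2 fun a => ⟨Projective.factorThru a g, Projective.factorThru_comp a g⟩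
  have e₂ : LinearMap.ker (Linear.rightComp k P.obj g) =
      LinearMap.range (Linear.rightComp k P.obj f) := by
    ext a
    constructor
    · intro ha
      exact ⟨hS.exact.lift a ha, hS.exact.lift_f a ha⟩
    · rintro ⟨b, rfl⟩
      change (b ≫ f) ≫ g = 0
      rw [Category.assoc, h, comp_zero]
  have e₃ : Function.Injective (Linear.rightComp k P.obj f) := fun a b hab =>
    (cancel_mono f).1 hab
  rw [e₁, e₂, finrank_top, LinearMap.finrank_range_of_inj e₃] at h₁
  omega

variable (k) in
/-- The connecting map `Hom(X₁, M) → Ext¹(X₃, M)` of a short exact sequence. -/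
def extConnecting {S : ShortComplex (ModuleCat.{v} Bᵐᵒᵖ)} (hS : S.ShortExact)
    (M : ModuleCat.{v} Bᵐᵒᵖ) : (S.X₁ ⟶ M) →ₗ[k] Ext S.X₃ M 1 :=
  Ext.precompOfLinear hS.extClass k M (a := 0) (b := 1) rfl ∘ₗ
    (Ext.linearEquiv₀ (R := k)).symm.toLinearMap

lemma extConnecting_apply {S : ShortComplex (ModuleCat.{v} Bᵐᵒᵖ)} (hS : S.ShortExact)
    {M : ModuleCat.{v} Bᵐᵒᵖ} (a : S.X₁ ⟶ M) :
    extConnecting k hS M a = hS.extClass.comp (Ext.mk₀ a) rfl := rfl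

lemma extConnecting_surjective {S : ShortComplex (ModuleCat.{v} Bᵐᵒᵖ)} (hS : S.ShortExact)
    [Projective S.X₂] (M : ModuleCat.{v} Bᵐᵒᵖ) :
    Function.Surjective (extConnecting k hS M) := fun x => by
  obtain ⟨y, hy⟩ :=
    Ext.contravariant_sequence_exact₃ hS M x (Ext.eq_zero_of_projective _) (n₀ := 0) rfl
  obtain ⟨a, rfl⟩ := (Ext.linearEquiv₀ (R := k)).symm.surjective y
  exact ⟨a, hy⟩

lemma extConnecting_eq_zero_iff {S : ShortComplex (ModuleCat.{v} Bᵐᵒᵖ)} (hS : S.ShortExact)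
    {M : ModuleCat.{v} Bᵐᵒᵖ} (a : S.X₁ ⟶ M) :
    extConnecting k hS M a = 0 ↔ ∃ b : S.X₂ ⟶ M, S.f ≫ b = a := by
  rw [extConnecting_apply]
  constructor
  · intro h
    obtain ⟨y, hy⟩ := Ext.contravariant_sequence_exact₁ hS M (Ext.mk₀ a) rfl h
    obtain ⟨b, rfl⟩ := (Ext.linearEquiv₀ (R := k)).symm.surjective y
    refine ⟨b, (Ext.linearEquiv₀ (R := k)).symm.injective ?_⟩
    change Ext.mk₀ (S.f ≫ b) = Ext.mk₀ a
    rw [← hy, ← Ext.mk₀_comp_mk₀]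
    rfl
  · rintro ⟨b, rfl⟩
    rw [← Ext.mk₀_comp_mk₀, hS.extClass_comp_assoc]

end Modules

/-! ### The functor `F = C(T, -)` -/

section Functor

variable (k : Type w) [Field k] {C : Type u} [Category.{v} C] [Preadditive C] [Linear k C]
  [∀ X Y : C, Module.Finite k (X ⟶ Y)] (T : C)

/-- The functor `F` on morphisms. -/
def Fmap (X Y : C) : (X ⟶ Y) →ₗ[k] ((F k T X).obj ⟶ (F k T Y).obj) where
  toFun a := (preadditiveCoyonedaObj T).map a
  map_add' _ _ := Functor.map_add _
  map_smul' r a := by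
    ext t
    change (T ⟶ X) at t
    change t ≫ (r • a) = (r • 𝟙 T) ≫ t ≫ a
    rw [Linear.comp_smul, Linear.smul_comp, Category.id_comp]

variable {k T}

lemma Fmap_apply {X Y : C} (a : X ⟶ Y) (t : T ⟶ X) :
    (Fmap k T X Y a).hom t = (t ≫ a : T ⟶ Y) := rfl

lemma Fmap_comp {X Y Z : C} (a : X ⟶ Y) (b : Y ⟶ Z) :
    Fmap k T X Z (a ≫ b) = Fmap k T X Y a ≫ Fmap k T Y Z b :=
  (preadditiveCoyonedaObj T).map_comp a b

lemma Fmap_eq_zero_iff {X Y : C} (a : X ⟶ Y) :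
    Fmap k T X Y a = 0 ↔ ∀ t : T ⟶ X, t ≫ a = 0 := by
  constructor
  · intro h t
    rw [← Fmap_apply (k := k), h]
    rfl
  · intro h
    ext t
    exact h t

lemma hom_precomp {X : C} {N : ModuleCat.{v} (End T)ᵐᵒᵖ} (φ : (F k T X).obj ⟶ N) (s : T ⟶ T)
    (t : T ⟶ X) : φ.hom (s ≫ t : T ⟶ X) = (MulOpposite.op s : (End T)ᵐᵒᵖ) • φ.hom t :=
  φ.hom.map_smul (MulOpposite.op s) t

lemma IsAddRetract.Fmap_bijective {P : C} (hP : IsAddRetract T P) (Y : C) :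
    Function.Bijective (Fmap k T P Y) := by
  constructor
  · rw [injective_iff_map_eq_zero]
    intro u hu
    rw [← Category.id_comp u]
    exact hP.comp_eq_zero ((Fmap_eq_zero_iff u).1 hu) (𝟙 P)
  · intro φ
    obtain ⟨n, p, q, hpq⟩ := hP
    refine ⟨∑ i, p i ≫ (φ.hom (q i) : T ⟶ Y), ?_⟩
    ext t
    change (T ⟶ P) at t
    have ht : t = ∑ i, (t ≫ p i) ≫ q i := by
      simp only [Category.assoc, ← Preadditive.comp_sum, hpq, Category.comp_id]
    rw [Fmap_apply, Preadditive.comp_sum]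
    conv_rhs => rw [ht]
    refine Eq.trans ?_ (map_sum φ.hom _ _).symm
    refine Finset.sum_congr rfl fun i _ => ?_
    rw [hom_precomp]
    exact (Category.assoc _ _ _).symm

/-- `C(P, Y) ≃ Hom(FP, FY)` for `P` in `add T`. -/
def IsAddRetract.homEquiv {P : C} (hP : IsAddRetract T P) (Y : C) :
    (P ⟶ Y) ≃ₗ[k] ((F k T P).obj ⟶ (F k T Y).obj) :=
  LinearEquiv.ofBijective (Fmap k T P Y) (hP.Fmap_bijective Y)

/-- The morphism `FP ⟶ N` given by `t ↦ ∑ i, xᵢ · (t ≫ pᵢ)`. -/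
def homOfElements {P : C} {N : ModuleCat.{v} (End T)ᵐᵒᵖ} {n : ℕ} (p : Fin n → (P ⟶ T))
    (x : Fin n → N) : (F k T P).obj ⟶ N :=
  ModuleCat.ofHom
    { toFun := fun t => ∑ i, (MulOpposite.op ((t : T ⟶ P) ≫ p i) : (End T)ᵐᵒᵖ) • x i
      map_add' := fun s t => by
        rw [← Finset.sum_add_distrib]
        refine Finset.sum_congr rfl fun i _ => ?_
        rw [← add_smul]
        congr 1
        exact congrArg MulOpposite.op (Preadditive.add_comp _ _ _ s t (p i))
      map_smul' := fun r t => by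
        rw [RingHom.id_apply, Finset.smul_sum]
        refine Finset.sum_congr rfl fun i _ => ?_
        rw [smul_smul]
        congr 1
        exact congrArg MulOpposite.op (Category.assoc r.unop t (p i)) }

lemma homOfElements_apply {P : C} {N : ModuleCat.{v} (End T)ᵐᵒᵖ} {n : ℕ} (p : Fin n → (P ⟶ T))
    (x : Fin n → N) (t : T ⟶ P) : (homOfElements (k := k) p x).hom t =
      ∑ i, (MulOpposite.op (t ≫ p i) : (End T)ᵐᵒᵖ) • x i := rfl

lemma IsAddRetract.projective {P : C} (hP : IsAddRetract T P) : Projective (F k T P).obj where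
  factors {E N} φ e he := by
    rw [ModuleCat.epi_iff_surjective] at he
    obtain ⟨n, p, q, hpq⟩ := hP
    choose x hx using fun i => he (φ.hom (q i))
    refine ⟨homOfElements p x, ?_⟩
    ext t
    change (T ⟶ P) at t
    have ht : t = ∑ i, (t ≫ p i) ≫ q i := by
      simp only [Category.assoc, ← Preadditive.comp_sum, hpq, Category.comp_id]
    change e.hom ((homOfElements p x).hom t) = φ.hom t
    rw [homOfElements_apply, map_sum]
    conv_rhs => rw [ht]
    refine Eq.trans ?_ (map_sum φ.hom _ _).symm
    refine Finset.sum_congr rfl fun i _ => ?_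
    rw [hom_precomp, map_smul, hx]

end Functor

section Triangulated

variable {k : Type w} [Field k] {C : Type u} [Category.{v} C] [Preadditive C] [Linear k C]
  [∀ X Y : C, Module.Finite k (X ⟶ Y)]
  [HasZeroObject C] [HasShift C ℤ] [∀ n : ℤ, (shiftFunctor C n).Additive] [Pretriangulated C]
  {T X : C}

lemma Approx.Fmap_surjective (A : Approx T X) (hT : ∀ f : T ⟶ T⟦(1 : ℤ)⟧, f = 0) :
    Function.Surjective (Fmap k T A.P₀ X A.g).hom := A.exists_lift hT

lemma Approx.Fmap_full (A : Approx T X) (hT : ∀ f : T ⟶ T⟦(1 : ℤ)⟧, f = 0) (Y : C) :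
    Function.Surjective (Fmap k T X Y) := fun φ => by
  obtain ⟨u, hu⟩ := (A.mem₀.Fmap_bijective Y).2 (Fmap k T A.P₀ X A.g ≫ φ)
  have hfu : A.f ≫ u = 0 := (A.mem₁.Fmap_bijective (k := k) Y).1 (by
    rw [Fmap_comp, hu, ← Category.assoc, ← Fmap_comp, A.comp_f_g, map_zero, map_zero, zero_comp])
  obtain ⟨a, rfl⟩ := A.exists_factor hfu
  refine ⟨a, ?_⟩
  have : Epi (Fmap k T A.P₀ X A.g) :=
    (ModuleCat.epi_iff_surjective _).2 (A.Fmap_surjective (k := k) hT)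
  rw [← cancel_epi (Fmap k T A.P₀ X A.g), ← hu, Fmap_comp]

lemma Approx.finrank_hom (A : Approx T X) (hT : ∀ f : T ⟶ T⟦(1 : ℤ)⟧, f = 0) (Y : C) :
    Module.finrank k ((F k T X).obj ⟶ (F k T Y).obj) + Module.finrank k (ann k T X Y) =
      Module.finrank k (X ⟶ Y) := by
  have h := (Fmap k T X Y).finrank_range_add_finrank_ker
  have e : LinearMap.ker (Fmap k T X Y) = ann k T X Y := by
    ext a
    exact Fmap_eq_zero_iff a
  rwa [LinearMap.range_eq_top.2 (A.Fmap_full hT Y), e, finrank_top] at h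

/-- `Ext¹(FX, FY)` has the dimension of the space of those `X ⟶ ΣY` that are killed both by
`C(T, -)` and by `C(ΣT, -)`. -/
lemma Approx.finrank_ext [(shiftFunctor C (1 : ℤ)).Linear k] (A : Approx T X)
    (hT : ∀ f : T ⟶ T⟦(1 : ℤ)⟧, f = 0) (Y : C) :
    Module.finrank k (Ext (F k T X).obj (F k T Y).obj 1) =
      Module.finrank k (ann k T X (Y⟦(1 : ℤ)⟧) ⊓ ann k (T⟦(1 : ℤ)⟧) X (Y⟦(1 : ℤ)⟧) :
        Submodule k (X ⟶ Y⟦(1 : ℤ)⟧)) := by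
  let p : (F k T A.P₀).obj ⟶ (F k T X).obj := Fmap k T A.P₀ X A.g
  let q : (F k T A.P₁).obj ⟶ (F k T A.P₀).obj := Fmap k T A.P₁ A.P₀ A.f
  have hp : Epi p := (ModuleCat.epi_iff_surjective _).2 (A.Fmap_surjective (k := k) hT)
  have hqp : q ≫ p = 0 := by
    rw [← Fmap_comp (k := k) (T := T) A.f A.g, A.comp_f_g, map_zero]
  let S := ShortComplex.mk _ _ (kernel.condition p)
  have hS : S.ShortExact :=
    { exact := ShortComplex.exact_of_f_is_kernel _ (kernelIsKernel p) }
  have : Projective S.X₂ := A.mem₀.projective (k := k)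
  let π : (F k T A.P₁).obj ⟶ S.X₁ := kernel.lift p q hqp
  have hπ : π ≫ S.f = q := kernel.lift_ι p q hqp
  have hfinj : Function.Injective S.f.hom := (ModuleCat.mono_iff_injective _).1 hS.mono_f
  have hπsurj : Function.Surjective π.hom := fun z => by
    have hz : p.hom (S.f.hom z) = 0 := congrArg (fun m => m.hom z) (kernel.condition p)
    obtain ⟨t, ht⟩ := Triangle.coyoneda_exact₂ _ A.dist (S.f.hom z : T ⟶ A.P₀) hz
    refine ⟨t, hfinj ?_⟩
    exact (congrArg (fun m => m.hom t) hπ).trans ht.symm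
  have : Epi π := (ModuleCat.epi_iff_surjective _).2 hπsurj
  let M := (F k T Y).obj
  let Ω : FDMod k (End T) := ⟨S.X₁, finite_of_injective (hN := (F k T A.P₀).property) S.f hfinj⟩
  have : Module.Finite k (S.X₁ ⟶ M) := finiteHom Ω (F k T Y)
  let ψ : (S.X₁ ⟶ M) →ₗ[k] (A.P₁ ⟶ Y) :=
    (A.mem₁.homEquiv Y).symm.toLinearMap ∘ₗ Linear.leftComp k M π
  have hψ : ∀ a, Fmap k T A.P₁ Y (ψ a) = π ≫ a := fun a =>
    (A.mem₁.homEquiv Y).apply_symm_apply (π ≫ a)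
  have hker : LinearMap.ker (extConnecting k hS M) =
      LinearMap.ker (A.connecting Y ∘ₗ ψ) := by
    ext a
    rw [LinearMap.mem_ker, LinearMap.mem_ker, extConnecting_eq_zero_iff, LinearMap.comp_apply,
      connecting_apply, A.δ_comp_eq_zero_iff]
    constructor
    · rintro ⟨b, rfl⟩
      obtain ⟨u₀, rfl⟩ := (A.mem₀.Fmap_bijective (k := k) Y).2 b
      refine ⟨u₀, (A.mem₁.Fmap_bijective (k := k) Y).1 ?_⟩
      rw [hψ, ← Category.assoc, hπ, Fmap_comp]
    · rintro ⟨u₀, hu₀⟩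
      refine ⟨Fmap k T A.P₀ Y u₀, ?_⟩
      rw [← cancel_epi π, ← hψ a, ← hu₀, ← Category.assoc, hπ, Fmap_comp]
  have hrange : LinearMap.range (A.connecting Y ∘ₗ ψ) =
      ann k T X (Y⟦(1 : ℤ)⟧) ⊓ ann k (T⟦(1 : ℤ)⟧) X (Y⟦(1 : ℤ)⟧) := by
    ext a
    constructor
    · rintro ⟨b, rfl⟩
      refine ⟨A.δ_comp_mem_ann hT _, (A.mem_ann_shift_iff _).2 fun t ht => ?_⟩
      have h : π.hom t = 0 := hfinj (by
        rw [map_zero]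
        exact (congrArg (fun m => m.hom t) hπ).trans ht)
      rw [← Fmap_apply (k := k), hψ]
      change b.hom (π.hom t) = 0
      rw [h, map_zero]
    · rintro ⟨h₁, h₂⟩
      obtain ⟨u, rfl⟩ := A.exists_of_mem_ann hT h₁
      have h₃ := (A.mem_ann_shift_iff u).1 h₂
      have hu : kernel.ι π ≫ Fmap k T A.P₁ Y u = 0 := by
        ext z
        refine h₃ _ ?_
        have hz : π.hom ((kernel.ι π).hom z) = 0 :=
          congrArg (fun m => m.hom z) (kernel.condition π)
        have h := congrArg (fun m => m.hom ((kernel.ι π).hom z)) hπ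
        refine h.symm.trans ?_
        change S.f.hom (π.hom _) = 0
        rw [hz, map_zero]
      refine ⟨Abelian.epiDesc π _ hu, ?_⟩
      rw [LinearMap.comp_apply, connecting_apply]
      congr 2
      apply (A.mem₁.Fmap_bijective (k := k) Y).1
      rw [hψ, Abelian.comp_epiDesc]
  have h₁ := (extConnecting k hS M).finrank_range_add_finrank_ker
  have h₂ := (A.connecting Y ∘ₗ ψ).finrank_range_add_finrank_ker
  rw [LinearMap.range_eq_top.2 (extConnecting_surjective hS M), finrank_top, hker] at h₁
  rw [hrange] at h₂
  exact Nat.add_right_cancel (h₁.trans h₂.symm)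

end Triangulated

/-! ### The antisymmetrized form in terms of approximation triangles -/

section Triangulated

variable {k : Type w} [Field k] {C : Type u} [Category.{v} C] [Preadditive C] [Linear k C]
  [∀ X Y : C, Module.Finite k (X ⟶ Y)]
  [HasZeroObject C] [HasShift C ℤ] [∀ n : ℤ, (shiftFunctor C n).Additive] [Pretriangulated C]
  {T : C}

lemma exists_iso_F (hT : ∀ f : T ⟶ T⟦(1 : ℤ)⟧, f = 0) (N : FDMod k (End T)) :
    ∃ X : C, Nonempty (N ≅ F k T X) := by
  obtain ⟨n, x, hx⟩ := Module.Finite.exists_fin (R := k) (M := N.obj)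
  let P₀ : C := ⨁ fun _ : Fin n => T
  let ψ : (F k T P₀).obj ⟶ N.obj := homOfElements (biproduct.π (fun _ : Fin n => T)) x
  have hψ : Function.Surjective ψ.hom := by
    have h : Submodule.span k (Set.range x) ≤ LinearMap.range (ψ.hom.restrictScalars k) := by
      rw [Submodule.span_le]
      rintro _ ⟨i, rfl⟩
      refine ⟨(biproduct.ι (fun _ : Fin n => T) i : T ⟶ P₀), ?_⟩
      refine (homOfElements_apply (k := k) _ x (biproduct.ι (fun _ : Fin n => T) i)).trans ?_
      rw [Finset.sum_eq_single i]
      · rw [biproduct.ι_π_self]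
        exact one_smul (End T)ᵐᵒᵖ (x i)
      · intro j _ hj
        rw [biproduct.ι_π_ne _ hj.symm]
        exact zero_smul (End T)ᵐᵒᵖ (x j)
      · exact fun h => (h (Finset.mem_univ i)).elim
    intro y
    exact h (hx ▸ Submodule.mem_top)
  have : Module.Finite k (LinearMap.ker (ψ.hom.restrictScalars k)) := inferInstance
  obtain ⟨m, y, hy⟩ := Module.Finite.exists_fin (R := k)
    (M := LinearMap.ker (ψ.hom.restrictScalars k))
  let y' : Fin m → (T ⟶ P₀) := fun j => (y j).1
  have hy' : ∀ j, ψ.hom (y' j) = 0 := fun j => (y j).2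
  let f : (⨁ fun _ : Fin m => T) ⟶ P₀ := biproduct.desc y'
  obtain ⟨X, g, δ, dist⟩ := distinguished_cocone_triangle f
  have hfg : f ≫ g = 0 := comp_distTriang_mor_zero₁₂ _ dist
  have hg : Function.Surjective (Fmap k T P₀ X g).hom := fun t => by
    obtain ⟨s, hs⟩ := Triangle.coyoneda_exact₃ _ dist (t : T ⟶ X)
      (((isAddRetract_biproduct T m).map (shiftFunctor C (1 : ℤ))).hom_eq_zero hT _)
    exact ⟨s, hs.symm⟩
  have hfψ : Fmap k T _ _ f ≫ ψ = 0 := by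
    ext t
    change (T ⟶ ⨁ fun _ : Fin m => T) at t
    change ψ.hom (t ≫ f) = 0
    have ht : t ≫ f = ∑ j, (t ≫ biproduct.π _ j) ≫ y' j := by
      simp only [Category.assoc, ← Preadditive.comp_sum, f, biproduct.desc_eq]
    rw [ht]
    refine (map_sum ψ.hom _ _).trans (Finset.sum_eq_zero fun j _ => ?_)
    rw [hom_precomp, hy', smul_zero]
  have hker : LinearMap.ker ψ.hom = LinearMap.ker (Fmap k T P₀ X g).hom := by
    ext t
    change (T ⟶ P₀) at t
    constructor
    · intro ht
      have h : Submodule.span k (Set.range y) ≤ (LinearMap.ker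
          ((Fmap k T P₀ X g).hom.restrictScalars k)).comap (Submodule.subtype _) := by
        rw [Submodule.span_le]
        rintro _ ⟨j, rfl⟩
        change y' j ≫ g = 0
        have hj : biproduct.ι (fun _ : Fin m => T) j ≫ f = y' j := biproduct.ι_desc _ _
        rw [← hj, Category.assoc, hfg, comp_zero]
      have h' : (⟨t, ht⟩ : LinearMap.ker (ψ.hom.restrictScalars k)) ∈
        Submodule.span k (Set.range y) := hy ▸ Submodule.mem_top
      exact h h'
    · intro ht
      obtain ⟨s, hs⟩ := Triangle.coyoneda_exact₂ _ dist t ht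
      change ψ.hom t = 0
      rw [hs]
      exact congrArg (fun m => m.hom s) hfψ
  exact ⟨X, ⟨(isFD k (End T)).isoMk (LinearEquiv.toModuleIso
    ((ψ.hom.quotKerEquivOfSurjective hψ).symm ≪≫ₗ Submodule.quotEquivOfEq _ _ hker ≪≫ₗ
      (Fmap k T P₀ X g).hom.quotKerEquivOfSurjective hg))⟩⟩

lemma exists_iso_F_shift (hT : ∀ f : T ⟶ T⟦(1 : ℤ)⟧, f = 0) (N : FDMod k (End T)) :
    ∃ X : C, Nonempty (N ≅ F k T (X⟦(1 : ℤ)⟧)) := by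
  obtain ⟨X, ⟨e⟩⟩ := exists_iso_F hT N
  let i : X ≅ (X⟦(-1 : ℤ)⟧)⟦(1 : ℤ)⟧ := (shiftFunctorCompIsoId C (-1 : ℤ) 1 (by simp)).symm.app X
  exact ⟨X⟦(-1 : ℤ)⟧, ⟨e ≪≫ (isFD k (End T)).isoMk ((preadditiveCoyonedaObj T).mapIso i)⟩⟩

variable [∀ n : ℤ, (shiftFunctor C n).Linear k]

/-- `⟨FX, FY⟩ₐ` is the sum of the indices of `X` and `Σ⁻¹X` evaluated on `FY`. -/
lemma pairing_sub_pairing (hCY : IsTwoCalabiYau k C) (hT : IsTilting T) {X' : C}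
    (A' : Approx T X') (A : Approx T (X'⟦(1 : ℤ)⟧)) (Y : C) :
    pairing (F k T (X'⟦(1 : ℤ)⟧)) (F k T Y) - pairing (F k T Y) (F k T (X'⟦(1 : ℤ)⟧)) =
      (Module.finrank k (A.P₀ ⟶ Y) : ℤ) - Module.finrank k (A.P₁ ⟶ Y) +
        (Module.finrank k (A'.P₀ ⟶ Y) - Module.finrank k (A'.P₁ ⟶ Y)) := by
  obtain ⟨AY⟩ := hT.exists_approx hCY Y
  obtain ⟨AS⟩ := hT.shift.exists_approx hCY (X'⟦(1 : ℤ)⟧)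
  obtain ⟨φ, hφ⟩ := hCY
  have o₁ := A.orth_ann hT.rigid φ hφ Y
  have o₂ := AS.orth_ann hT.shift.rigid φ hφ Y
  have o₃ := finrank_add_finrank_orth (φ X' Y) (ann k T X' (Y⟦(1 : ℤ)⟧))
  rw [A'.orth_ann hT.rigid φ hφ Y] at o₃
  have o₄ := finrank_add_finrank_orth (φ (X'⟦(1 : ℤ)⟧) Y)
    (ann k T (X'⟦(1 : ℤ)⟧) (Y⟦(1 : ℤ)⟧) ⊔ ann k (T⟦(1 : ℤ)⟧) (X'⟦(1 : ℤ)⟧) (Y⟦(1 : ℤ)⟧))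
  rw [orth_sup, o₁, o₂] at o₄
  have o₅ := Submodule.finrank_sup_add_finrank_inf_eq
    (ann k T (X'⟦(1 : ℤ)⟧) (Y⟦(1 : ℤ)⟧)) (ann k (T⟦(1 : ℤ)⟧) (X'⟦(1 : ℤ)⟧) (Y⟦(1 : ℤ)⟧))
  have c₁ := (φ X' Y).finrank_eq.trans Subspace.dual_finrank_eq
  have h₁ := A.finrank_hom (k := k) hT.rigid Y
  have h₂ := AY.finrank_hom (k := k) hT.rigid (X'⟦(1 : ℤ)⟧)
  have x₁ := A.finrank_ext (k := k) hT.rigid Y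
  have x₂ := AY.finrank_ext (k := k) hT.rigid (X'⟦(1 : ℤ)⟧)
  have a₁ := A.finrank_ann (k := k) hT.rigid Y
  have a₂ := A'.finrank_ann (k := k) hT.rigid Y
  have s₁ := finrank_hom_shift (k := k) X' Y
  have s₂ := finrank_ann_shift (k := k) (U := T) X' Y
  rw [pairing, pairing]
  omega

lemma formA_mk_eq_add (hCY : IsTwoCalabiYau k C) (hT : IsTilting T)
    (N : FDMod k (End T)) {X Y Z : FDMod k (End T)} {f : X.obj ⟶ Y.obj} {g : Y.obj ⟶ Z.obj}
    {h : f ≫ g = 0} (hS : (ShortComplex.mk f g h).ShortExact) :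
    formA k (End T) (K0sp.mk N) (K0sp.mk Y) =
      formA k (End T) (K0sp.mk N) (K0sp.mk X) + formA k (End T) (K0sp.mk N) (K0sp.mk Z) := by
  obtain ⟨X', ⟨e⟩⟩ := exists_iso_F_shift hT.rigid N
  obtain ⟨A'⟩ := hT.exists_approx hCY X'
  obtain ⟨A⟩ := hT.exists_approx hCY (X'⟦(1 : ℤ)⟧)
  have hom_eq {P W : C} (hP : IsAddRetract T P) {M : FDMod k (End T)} (i : M ≅ F k T W) :
      Module.finrank k (P ⟶ W) = Module.finrank k ((F k T P).obj ⟶ M.obj) :=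
    ((hP.homEquiv W).trans (Linear.homCongr k (Iso.refl _)
      ((isFD k (End T)).ι.mapIso i.symm))).finrank_eq
  have key (M : FDMod k (End T)) : formA k (End T) (K0sp.mk N) (K0sp.mk M) =
      (Module.finrank k ((F k T A.P₀).obj ⟶ M.obj) : ℤ) -
        Module.finrank k ((F k T A.P₁).obj ⟶ M.obj) +
        (Module.finrank k ((F k T A'.P₀).obj ⟶ M.obj) -
          Module.finrank k ((F k T A'.P₁).obj ⟶ M.obj)) := by
    obtain ⟨W, ⟨i⟩⟩ := exists_iso_F hT.rigid M
    rw [formA_mk, pairing_congr e i, pairing_congr i e, pairing_sub_pairing hCY hT A' A W,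
      hom_eq A.mem₀ i, hom_eq A.mem₁ i, hom_eq A'.mem₀ i, hom_eq A'.mem₁ i]
  have := A.mem₀.projective (k := k)
  have := A.mem₁.projective (k := k)
  have := A'.mem₀.projective (k := k)
  have := A'.mem₁.projective (k := k)
  rw [key, key, key, finrank_hom_of_projective hS, finrank_hom_of_projective hS,
    finrank_hom_of_projective hS, finrank_hom_of_projective hS]
  push_cast
  ring

end Triangulated

/-! ### Descent to the Grothendieck group -/

section Descent

variable {k : Type w} [Field k] {B : Type v} [Ring B] [Algebra k B]

lemma toK0_surjective : Function.Surjective (toK0 k B) := fun x => by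
  obtain ⟨x, rfl⟩ := QuotientAddGroup.mk_surjective x
  exact ⟨QuotientAddGroup.mk x, rfl⟩

/-- A homomorphism on the split Grothendieck group that is additive on short exact sequences
descends to the Grothendieck group. -/
lemma exists_factor_toK0 {A : Type*} [AddCommGroup A] (l : K0sp k B →+ A)
    (hl : ∀ {X Y Z : FDMod k B} {f : X.obj ⟶ Y.obj} {g : Y.obj ⟶ Z.obj} {h : f ≫ g = 0},
      (ShortComplex.mk f g h).ShortExact → l (K0sp.mk Y) = l (K0sp.mk X) + l (K0sp.mk Z)) :
    ∃ l' : K0 k B →+ A, ∀ x, l' (toK0 k B x) = l x := by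
  refine ⟨QuotientAddGroup.lift _ (l.comp (QuotientAddGroup.mk' _)) ?_, ?_⟩
  · rw [AddSubgroup.closure_le]
    rintro _ ⟨X, Y, Z, f, g, h, hS, rfl⟩
    rw [SetLike.mem_coe, AddMonoidHom.mem_ker, map_sub, map_sub]
    change l (K0sp.mk Y) - l (K0sp.mk X) - l (K0sp.mk Z) = 0
    rw [hl hS]
    abel
  · intro x
    obtain ⟨x, rfl⟩ := QuotientAddGroup.mk_surjective x
    rfl

lemma formA_antisymm [Module.Finite k B] (x y : K0sp k B) : formA k B x y = -formA k B y x := by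
  simp [formA]

lemma exists_form_of_additive [Module.Finite k B]
    (hadd : ∀ (N : FDMod k B) {X Y Z : FDMod k B} {f : X.obj ⟶ Y.obj} {g : Y.obj ⟶ Z.obj}
      {h : f ≫ g = 0}, (ShortComplex.mk f g h).ShortExact →
      formA k B (K0sp.mk N) (K0sp.mk Y) =
        formA k B (K0sp.mk N) (K0sp.mk X) + formA k B (K0sp.mk N) (K0sp.mk Z)) :
    ∃ β : K0 k B →+ K0 k B →+ ℤ, ∀ x y, β (toK0 k B x) (toK0 k B y) = formA k B x y := by
  obtain ⟨γ, hγ⟩ := exists_factor_toK0 (formA k B) fun hS => K0sp.hom_ext fun N => by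
    rw [AddMonoidHom.add_apply, formA_antisymm, hadd N hS, formA_antisymm (K0sp.mk N),
      formA_antisymm (K0sp.mk N)]
    abel
  obtain ⟨β, hβ⟩ := exists_factor_toK0 γ.flip fun {X Y Z _ _ _} hS => by
    refine AddMonoidHom.ext fun x => ?_
    obtain ⟨x, rfl⟩ := toK0_surjective x
    simp only [AddMonoidHom.add_apply, AddMonoidHom.flip_apply, hγ]
    revert x
    refine DFunLike.congr_fun (f := (formA k B).flip (K0sp.mk Y))
      (g := (formA k B).flip (K0sp.mk X) + (formA k B).flip (K0sp.mk Z)) (K0sp.hom_ext fun N => ?_)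
    exact hadd N hS
  refine ⟨β.flip, fun x y => ?_⟩
  rw [AddMonoidHom.flip_apply, hβ, AddMonoidHom.flip_apply, hγ]

end Descent

end TwoCY

end

theorem theorem3p3 {k : Type w} [Field k] [IsAlgClosed k]
    {C : Type u} [Category.{v} C] [Preadditive C] [Linear k C] [HasZeroObject C]
    [HasShift C ℤ] [∀ n : ℤ, (shiftFunctor C n).Additive]
    [∀ n : ℤ, (shiftFunctor C n).Linear k]
    [Pretriangulated C] [IsTriangulated C] [IsIdempotentComplete C]
    [∀ X Y : C, Module.Finite k (X ⟶ Y)]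
    (hCY : TwoCY.IsTwoCalabiYau k C) (T : C) (hT : TwoCY.IsClusterTilting T) :
    (∃ β : TwoCY.K0 k (End T) →+ TwoCY.K0 k (End T) →+ ℤ,
      (∀ x y : TwoCY.K0sp k (End T),
        β (TwoCY.toK0 k (End T) x) (TwoCY.toK0 k (End T) y) =
          TwoCY.formA k (End T) x y) ∧
      (∀ x y : TwoCY.K0 k (End T), β x y = -β y x) ∧
      ∀ β' : TwoCY.K0 k (End T) →+ TwoCY.K0 k (End T) →+ ℤ,
        (∀ x y : TwoCY.K0sp k (End T),
          β' (TwoCY.toK0 k (End T) x) (TwoCY.toK0 k (End T) y) =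
            TwoCY.formA k (End T) x y) → β' = β) ∧
    ∀ X : C, Indecomposable X → TwoCY.IsSummand X T →
      ∃! l : TwoCY.K0 k (End T) →+ ℤ, ∀ y : TwoCY.K0sp k (End T),
        l (TwoCY.toK0 k (End T) y) =
          TwoCY.formA k (End T) (TwoCY.K0sp.mk (TwoCY.top (TwoCY.F k T X))) y := by
  obtain ⟨β, hβ⟩ := TwoCY.exists_form_of_additive (k := k) (B := End T)
    fun N => TwoCY.formA_mk_eq_add hCY hT.isTilting N
  refine ⟨⟨β, hβ, fun x y => ?_, fun β' hβ' => ?_⟩, fun X _ _ => ?_⟩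
  · obtain ⟨x, rfl⟩ := TwoCY.toK0_surjective x
    obtain ⟨y, rfl⟩ := TwoCY.toK0_surjective y
    rw [hβ, hβ, TwoCY.formA_antisymm]
  · refine AddMonoidHom.ext fun x => AddMonoidHom.ext fun y => ?_
    obtain ⟨x, rfl⟩ := TwoCY.toK0_surjective x
    obtain ⟨y, rfl⟩ := TwoCY.toK0_surjective y
    rw [hβ, hβ']
  · refine ⟨β (TwoCY.toK0 k (End T) (TwoCY.K0sp.mk (TwoCY.top (TwoCY.F k T X)))), hβ _,
      fun l hl => ?_⟩
    refine AddMonoidHom.ext fun y => ?_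
    obtain ⟨y, rfl⟩ := TwoCY.toK0_surjective y
    rw [hβ, hl]
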